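/- Fix constants $0<\alpha<1$, $0<\gamma\le 1$, $0<\epsilon\le 1$ and $\mu_1\neq 0$. For each $m\ge 1$ let $n=n(m)\ge 1$ be an integer, let $\mu_{m,1},\dots,\mu_{m,m}$ be real numbers with $\mu_{m,1}=\mu_1$, and let $X_{i,j}$, $1\le i\le m$, $1\le j\le n$, be independent random variables with $X_{i,j}\sim N(\mu_{m,i},1)$. (For $n=1$, where the statistics $T_{n,i}$ below are undefined, any convention may be used; this concerns only finitely many $m$.) Consider testing the hypotheses $H_i:\mu_{m,i}=0$ against $\mu_{m,i}\ne 0$, $i=1,\dots,m$, by the following two-stage procedure. Let $$S_{n,i}=\sum_{j=1}^n X_{i,j}^2,\qquad T_{n,i}=\frac{\sqrt n\,\overline X_{n,i}}{\hat\sigma_{n,i}},\qquad \overline X_{n,i}=\frac1n\sum_{j=1}^n X_{i,j},\qquad \hat\sigma_{n,i}^2=\frac1{n-1}\sum_{j=1}^n (X_{i,j}-\overline X_{n,i})^2 .$$ First stage: $H_i$ is selected iff $S_{n,i}\ge \chi^2_n(1-\beta)$, the $1-\beta$ quantile of the chi-squared distribution with $n$ degrees of freedom, where $\beta=m^{-(1-\gamma)}$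 (the $0$-quantile, which occurs when $\beta=1$, is $0$). Let $\hat S_n$ be the set of indices of the selected hypotheses. Second stage: $H_i$ is rejected iff it is selected and $|T_{n,i}|\ge t_{n-1}\bigl(1-\tfrac{\alpha}{2|\hat S_n|}\bigr)$, the $1-\tfrac{\alpha}{2|\hat S_n|}$ quantile of the $t$-distribution with $n-1$ degrees of freedom. Assume that $\lim_{m\to\infty}\frac{\log m}{n}=0$ and that the number of false null hypotheses satisfies $|\{i\le m:\mu_{m,i}\neq 0\}|\asymp m^{1-\epsilon}$ as $m\to\infty$. Then $$\lim_{m\to\infty}\Pr\{H_1\text{ is rejected}\}=1 .$$ -/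

import Mathlib

open MeasureTheory ProbabilityTheory Filter Topology Asymptotics

noncomputable section

namespace TwoStage

/-- The chi-squared distribution with `n` degrees of freedom: the law of the sum of the squares
of `n` independent standard normal variables. -/
def chiSquared (n : ℕ) : Measure ℝ :=
  (Measure.pi (fun _ : Fin n => gaussianReal 0 1)).map (fun z => ∑ j, z j ^ 2)

/-- The Student t-distribution with `ν` degrees of freedom: the law of `Z / √(V / ν)`, where `Z`
is standard normal, `V` is chi-squared with `ν` degrees of freedom, and they are independent. -/
def studentT (ν : ℕ) : Measure ℝ :=
  ((gaussianReal 0 1).prod (chiSquared ν)).map (fun p => p.1 / √(p.2 / (ν : ℝ)))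

/-- The `p`-quantile of the chi-squared distribution, a law on `[0, ∞)`; the infimum is taken
over that half-line, so the `0`-quantile is `0`. -/
def chiSquaredQuantile (n : ℕ) (p : ℝ) : ℝ :=
  sInf {x : ℝ | 0 ≤ x ∧ p ≤ (chiSquared n).real (Set.Iic x)}

/-- The `p`-quantile (`0 < p < 1`) of the t-distribution with `ν` degrees of freedom. -/
def studentTQuantile (ν : ℕ) (p : ℝ) : ℝ :=
  sInf {x : ℝ | p ≤ (studentT ν).real (Set.Iic x)}

/-- The selection statistic: the sum of squares of a sample. -/
def selectionStat {n : ℕ} (x : Fin n → ℝ) : ℝ := ∑ j, x j ^ 2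

/-- The sample mean. -/
def sampleMean {n : ℕ} (x : Fin n → ℝ) : ℝ := (1 / (n : ℝ)) * ∑ j, x j

/-- The unbiased sample variance. -/
def sampleVariance {n : ℕ} (x : Fin n → ℝ) : ℝ :=
  (1 / ((n : ℝ) - 1)) * ∑ j, (x j - sampleMean x) ^ 2

/-- The detection statistic: the t-statistic of a sample. -/
def tStat {n : ℕ} (x : Fin n → ℝ) : ℝ := √(n : ℝ) * sampleMean x / √(sampleVariance x)

open Classical in
/-- The set of hypotheses selected at the first stage with threshold `u`, for the data `x`
(`m` samples of size `n`). -/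
def selected {m n : ℕ} (u : ℝ) (x : Fin m → Fin n → ℝ) : Finset (Fin m) :=
  {i | u ≤ selectionStat (x i)}

/-- The selection threshold: the `1 - β` quantile of the chi-squared distribution with `n` degrees
of freedom, where `β = m ^ (-(1 - γ))`. -/
def threshold (m n : ℕ) (γ : ℝ) : ℝ := chiSquaredQuantile n (1 - (m : ℝ) ^ (-(1 - γ)))

/-- The two-stage procedure at level `α` rejects the `i`-th hypothesis: it is selected at the first
stage, and its t-statistic passes the Bonferroni critical value computed from the number of
selected hypotheses (a number that is positive whenever the `i`-th one is selected). -/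
def Rejects {m n : ℕ} (α γ : ℝ) (x : Fin m → Fin n → ℝ) (i : Fin m) : Prop :=
  i ∈ selected (threshold m n γ) x ∧
    studentTQuantile (n - 1)
        (1 - α / (2 * ((selected (threshold m n γ) x).card : ℝ))) ≤ |tStat (x i)|

/-- The number of false null hypotheses among `m` hypotheses with means `μ`. -/
def numFalse {m : ℕ} (μ : Fin m → ℝ) : ℕ := Nat.card {i : Fin m // μ i ≠ 0}

end TwoStage

end

namespace TwoStage

/-! Since `log m = o(n)`, any bound `exp(-c n)` eventually beats a constant multiple of `1/m`, so
both critical values are weak against a fixed mean `μ₁`. The selection threshold is at most `n(1 +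
μ₁²/2)` (`threshold_le`), while the selection statistic concentrates at `n(1 + μ₁²)`. The
t-statistic is at least `d√n` once the first two empirical moments are accurate (`le_abs_tStat`),
while the Bonferroni quantile is at most `d√n` for every possible number `k ≤ m` of selected
hypotheses (`studentTQuantile_bonferroni_le`), so the randomness of that number is harmless.
Chebyshev supplies the moments with error `O(1/n)`. -/

theorem measurable_sum_sq (n : ℕ) : Measurable (fun z : Fin n → ℝ => ∑ j, z j ^ 2) := by
  fun_prop

instance isProbabilityMeasure_chiSquared (n : ℕ) : IsProbabilityMeasure (chiSquared n) :=
  Measure.isProbabilityMeasure_map (measurable_sum_sq n).aemeasurable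

theorem measurable_studentize (ν : ℕ) :
    Measurable (fun p : ℝ × ℝ => p.1 / √(p.2 / (ν : ℝ))) := by
  fun_prop

instance isProbabilityMeasure_studentT (ν : ℕ) : IsProbabilityMeasure (studentT ν) :=
  Measure.isProbabilityMeasure_map (measurable_studentize ν).aemeasurable

/-! ### Exponential moments and Chernoff tails. -/

theorem gaussianPDFReal_smul_exp_mul_sq (t z : ℝ) :
    gaussianPDFReal 0 1 z • Real.exp (t * z ^ 2) =
      (√(2 * Real.pi))⁻¹ * Real.exp (-(1 / 2 - t) * z ^ 2) := by
  rw [gaussianPDFReal, smul_eq_mul, mul_assoc, ← Real.exp_add]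
  simp only [NNReal.coe_one, mul_one, sub_zero]
  ring_nf

theorem integrable_exp_mul_sq_gaussianReal {t : ℝ} (ht : t < 1 / 2) :
    Integrable (fun z : ℝ => Real.exp (t * z ^ 2)) (gaussianReal 0 1) := by
  rw [gaussianReal_of_var_ne_zero _ one_ne_zero,
    integrable_withDensity_iff_integrable_smul' (measurable_gaussianPDF _ _)
      (ae_of_all _ fun _ => gaussianPDF_lt_top)]
  simp only [toReal_gaussianPDF, gaussianPDFReal_smul_exp_mul_sq]
  exact (integrable_exp_neg_mul_sq (by linarith)).const_mul _

theorem integral_exp_mul_sq_gaussianReal {t : ℝ} (ht : t < 1 / 2) :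
    ∫ z, Real.exp (t * z ^ 2) ∂(gaussianReal 0 1) = √(1 / (1 - 2 * t)) := by
  rw [integral_gaussianReal_eq_integral_smul one_ne_zero]
  simp only [gaussianPDFReal_smul_exp_mul_sq]
  rw [integral_const_mul, integral_gaussian, ← Real.sqrt_inv, ← Real.sqrt_mul (by positivity)]
  congr 1
  have h : 1 - 2 * t ≠ 0 := by linarith
  have h' : 1 / 2 - t ≠ 0 := by linarith
  have := Real.pi_ne_zero
  field_simp

theorem exp_mul_sum_sq {n : ℕ} (t : ℝ) (z : Fin n → ℝ) :
    Real.exp (t * ∑ j, z j ^ 2) = ∏ j, Real.exp (t * z j ^ 2) := by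
  rw [Finset.mul_sum, Real.exp_sum]

theorem integrable_exp_mul_chiSquared (n : ℕ) {t : ℝ} (ht : t < 1 / 2) :
    Integrable (fun x => Real.exp (t * id x)) (chiSquared n) := by
  rw [chiSquared, integrable_map_measure (by fun_prop) (measurable_sum_sq n).aemeasurable]
  simp only [Function.comp_def, id, exp_mul_sum_sq]
  exact Integrable.fintype_prod fun _ => integrable_exp_mul_sq_gaussianReal ht

theorem mgf_id_chiSquared (n : ℕ) {t : ℝ} (ht : t < 1 / 2) :
    mgf id (chiSquared n) t = Real.exp (-(n / 2 * Real.log (1 - 2 * t))) := by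
  have hpos : 0 < 1 - 2 * t := by linarith
  rw [mgf, chiSquared, integral_map (measurable_sum_sq n).aemeasurable (by fun_prop)]
  simp only [id, exp_mul_sum_sq]
  rw [integral_fintype_prod_eq_pow (fun z : ℝ => Real.exp (t * z ^ 2)),
    integral_exp_mul_sq_gaussianReal ht, Fintype.card_fin,
    ← Real.exp_log (Real.sqrt_pos.2 (one_div_pos.2 hpos)), ← Real.exp_nat_mul,
    Real.log_sqrt (one_div_pos.2 hpos).le, one_div, Real.log_inv]
  ring_nf

/-- Chernoff bound for the upper tail of the chi-squared distribution, with an unspecified rate. -/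
theorem exists_chiSquared_upper_tail {δ : ℝ} (hδ : 0 < δ) :
    ∃ c > 0, ∀ n : ℕ, (chiSquared n).real (Set.Ici (n * (1 + δ))) ≤ Real.exp (-(c * n)) := by
  -- Here `s = 2t` for the Chernoff parameter `t`. It is half the optimal value `δ / (1 + δ)`, at
  -- which the bound `1 - 1/(1-s) ≤ log(1-s)` would only give a rate `≥ 0`.
  set s := δ / (2 * (1 + δ)) with hs
  have hs0 : 0 < s := by positivity
  have hs1 : s * (2 * (1 + δ)) = δ := by rw [hs]; field_simp
  have hlt : s < 1 / 2 := by nlinarith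
  have hlog := Real.one_sub_inv_le_log_of_pos (show 0 < 1 - s by linarith)
  have hinv : (1 - s)⁻¹ < 1 + s * (1 + δ) := by
    rw [inv_lt_iff_one_lt_mul₀ (by linarith)]
    nlinarith
  refine ⟨(s * (1 + δ) + Real.log (1 - s)) / 2, by linarith, fun n => ?_⟩
  have h := measure_ge_le_exp_mul_mgf (μ := chiSquared n) (X := id) (n * (1 + δ))
    (half_pos hs0).le (integrable_exp_mul_chiSquared n (by linarith))
  rw [mgf_id_chiSquared n (by linarith), ← Real.exp_add] at h
  refine h.trans_eq ?_
  ring_nf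

theorem chiSquared_lower_tail (n : ℕ) :
    (chiSquared n).real (Set.Iic (n / 2)) ≤ Real.exp (-(9 / 100 * n)) := by
  have h := measure_le_le_exp_mul_mgf (μ := chiSquared n) (X := id) (n / 2 : ℝ)
    (t := -1 / 2) (by norm_num) (integrable_exp_mul_chiSquared n (by norm_num))
  rw [mgf_id_chiSquared n (by norm_num), ← Real.exp_add,
    show (1 - 2 * (-1 / 2) : ℝ) = 2 by norm_num] at h
  refine h.trans (Real.exp_le_exp.2 ?_)
  -- The exponent is `n (1/4 - log 2 / 2)`, about `-0.097 n`.
  have := mul_le_mul_of_nonneg_left Real.log_two_gt_d9.le (Nat.cast_nonneg (α := ℝ) n)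
  nlinarith

theorem gaussianReal_upper_tail {x : ℝ} (hx : 0 ≤ x) :
    (gaussianReal 0 1).real (Set.Ici x) ≤ Real.exp (-(x ^ 2 / 2)) := by
  have h := measure_ge_le_exp_mul_mgf (μ := gaussianReal 0 1) (X := id) x hx
    (integrable_exp_mul_gaussianReal x)
  rw [mgf_id_gaussianReal, ← Real.exp_add] at h
  refine h.trans_eq ?_
  simp only [NNReal.coe_one]
  ring_nf

/-- A large ratio forces a large numerator unless the chi-squared variable is below half its mean.
The second term does not decay in `x`, which is harmless for `x` of order `√ν`. -/
theorem studentT_upper_tail {ν : ℕ} (hν : 0 < ν) {x : ℝ} (hx : 0 ≤ x) :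
    (studentT ν).real (Set.Ioi x) ≤
      Real.exp (-(x ^ 2 / 4)) + Real.exp (-(9 / 100 * ν)) := by
  have hν' : (0 : ℝ) < ν := Nat.cast_pos.2 hν
  rw [studentT, map_measureReal_apply (measurable_studentize ν) measurableSet_Ioi]
  have hsub : (fun p : ℝ × ℝ => p.1 / √(p.2 / (ν : ℝ))) ⁻¹' Set.Ioi x ⊆
      Set.Ici (x * √(1 / 2)) ×ˢ Set.univ ∪ Set.univ ×ˢ Set.Iic (ν / 2 : ℝ) := by
    rintro ⟨z, v⟩ h
    by_cases hv : v ≤ ν / 2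
    · exact Or.inr ⟨trivial, hv⟩
    · refine Or.inl ⟨?_, trivial⟩
      have hv2 : 1 / 2 ≤ v / ν := by
        rw [le_div_iff₀ hν']
        linarith
      have hpos : 0 < √(v / ν) := Real.sqrt_pos.2 (by linarith)
      have h1 : x * √(v / ν) < z := (lt_div_iff₀ hpos).1 h
      exact (mul_le_mul_of_nonneg_left (Real.sqrt_le_sqrt hv2) hx).trans h1.le
  refine (measureReal_mono hsub).trans ((measureReal_union_le _ _).trans (add_le_add ?_ ?_))
  · rw [measureReal_prod_prod, probReal_univ, mul_one]
    refine (gaussianReal_upper_tail (by positivity)).trans_eq ?_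
    rw [mul_pow, Real.sq_sqrt (by norm_num)]
    ring_nf
  · rw [measureReal_prod_prod, probReal_univ, one_mul]
    exact chiSquared_lower_tail ν

/-! ### Bounding quantiles by tails. -/

theorem chiSquaredQuantile_le {n : ℕ} {p x : ℝ} (hx : 0 ≤ x)
    (h : p ≤ (chiSquared n).real (Set.Iic x)) : chiSquaredQuantile n p ≤ x :=
  csInf_le ⟨0, fun _ hy => hy.1⟩ ⟨hx, h⟩

theorem studentTQuantile_le {ν : ℕ} {p x : ℝ} (hp : 0 < p)
    (h : p ≤ (studentT ν).real (Set.Iic x)) : studentTQuantile ν p ≤ x := by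
  refine csInf_le ?_ h
  -- The cdf tends to `0` at `-∞`, so `0 < p` bounds the set below.
  obtain ⟨b, hb⟩ := (((tendsto_cdf_atBot (studentT ν)).eventually_lt_const hp)).exists
  refine ⟨b, fun y hy => ?_⟩
  by_contra! hlt
  have := monotone_cdf (studentT ν) hlt.le
  simp only [cdf_eq_real] at this hb
  exact absurd (hy.trans (this.trans hb.le)) (not_le.2 (by
    rw [Set.mem_ofPred_eq] at hy
    linarith))

theorem one_sub_tail_le_real_Iic {ρ : Measure ℝ} [IsProbabilityMeasure ρ] (x : ℝ) :
    1 - ρ.real (Set.Ioi x) ≤ ρ.real (Set.Iic x) := by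
  rw [← Set.compl_Iic, probReal_compl_eq_one_sub measurableSet_Iic]
  linarith

/-! ### Empirical moments and the t-statistic. -/

/-- Chebyshev's inequality for the sum of a function of independent identically distributed
variables. -/
theorem measure_sum_deviation_le {Ω : Type*} [MeasurableSpace Ω] {P : Measure Ω}
    [IsProbabilityMeasure P] {ρ : Measure ℝ} {n : ℕ} (hn : 0 < n) {Y : Fin n → Ω → ℝ}
    (hY : ∀ j, HasLaw (Y j) ρ P) (hind : iIndepFun Y P) {f : ℝ → ℝ} (hf : Measurable f)
    (hf2 : MemLp f 2 ρ) {η : ℝ} (hη : 0 < η) :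
    P {ω | n * η ≤ |∑ j, f (Y j ω) - n * ∫ y, f y ∂ρ|} ≤
      ENNReal.ofReal (Var[f; ρ] / η ^ 2 / n) := by
  have hn' : (0 : ℝ) < n := Nat.cast_pos.2 hn
  have hL : ∀ j, MemLp (f ∘ Y j) 2 P := fun j => by
    rw [← (hY j).map_eq] at hf2
    exact (memLp_map_measure_iff hf.aestronglyMeasurable (hY j).aemeasurable).1 hf2
  have hlawf : HasLaw f (ρ.map f) ρ := ⟨hf.aemeasurable, rfl⟩
  have hvar : ∀ j, Var[f ∘ Y j; P] = Var[f; ρ] := fun j => by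
    rw [(hlawf.comp (hY j)).variance_eq, hlawf.variance_eq]
  have hsum : MemLp (∑ j, f ∘ Y j) 2 P := memLp_finsetSum' _ fun j _ => hL j
  have hint : ∫ ω, (∑ j, f ∘ Y j) ω ∂P = n * ∫ y, f y ∂ρ := by
    simp only [Finset.sum_apply]
    rw [integral_finsetSum _ fun j _ => (hL j).integrable one_le_two]
    simp_rw [(hY _).integral_comp hf.aestronglyMeasurable]
    simp
  have hV : Var[∑ j, f ∘ Y j; P] = n * Var[f; ρ] := by
    rw [IndepFun.variance_sum (fun j _ => hL j) fun i _ j _ hij =>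
      (hind.comp (fun _ => f) fun _ => hf).indepFun hij]
    simp [hvar]
  have h := meas_ge_le_variance_div_sq hsum (mul_pos hn' hη)
  rw [hint, hV] at h
  simp only [Finset.sum_apply, Function.comp_apply] at h
  refine h.trans_eq (congrArg _ ?_)
  field_simp

theorem sum_sub_sampleMean_sq {n : ℕ} (hn : 0 < n) (x : Fin n → ℝ) :
    ∑ j, (x j - sampleMean x) ^ 2 = selectionStat x - n * sampleMean x ^ 2 := by
  have hn' : (n : ℝ) ≠ 0 := by positivity
  have h : ∑ j, x j = n * sampleMean x := by
    rw [sampleMean]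
    field_simp
  simp only [sub_sq, Finset.sum_add_distrib, Finset.sum_sub_distrib, ← Finset.sum_mul,
    ← Finset.mul_sum, h, selectionStat]
  simp only [Finset.sum_const, Finset.card_univ, Fintype.card_fin, nsmul_eq_mul]
  ring

/-- If the first two empirical moments are close to those of `N(μ, 1)`, then the t-statistic is of
order at least `√n`. -/
theorem le_abs_tStat {n : ℕ} (hn : 2 ≤ n) {x : Fin n → ℝ} {μ η : ℝ}
    (hη1 : η ≤ 1 / 4) (hη2 : η ≤ |μ| / 2) (hη3 : η * |μ| ≤ 1 / 8)
    (hmean : |∑ j, x j - n * μ| < n * η)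
    (hsq : |selectionStat x - n * (1 + μ ^ 2)| < n * η) :
    |μ| / 2 / √(4 + 2 * μ ^ 2) * √n ≤ |tStat x| := by
  have hn' : (2 : ℝ) ≤ n := by exact_mod_cast hn
  have hA : |sampleMean x - μ| < η := by
    have h : ∑ j, x j - n * μ = n * (sampleMean x - μ) := by
      rw [sampleMean]
      field_simp
    rw [h, abs_mul, abs_of_pos (by linarith)] at hmean
    exact lt_of_mul_lt_mul_left hmean (by linarith)
  have hη0 : 0 < η := (abs_nonneg _).trans_lt hA
  have hAlow : |μ| / 2 ≤ |sampleMean x| := by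
    have := abs_sub_abs_le_abs_sub μ (sampleMean x)
    rw [abs_sub_comm] at this
    linarith
  have hAup : |sampleMean x| ≤ |μ| + η := by
    have := abs_sub_abs_le_abs_sub (sampleMean x) μ
    linarith
  have hA2 : sampleMean x ^ 2 ≤ μ ^ 2 + 2 * (η * |μ|) + η ^ 2 := by
    have := pow_le_pow_left₀ (abs_nonneg _) hAup 2
    rw [sq_abs] at this
    rw [← sq_abs μ]
    linarith
  have hηsq : η ^ 2 ≤ 1 / 16 := by nlinarith
  obtain ⟨hlo, hhi⟩ := abs_lt.1 hsq
  have hn1 : 0 < (n : ℝ) - 1 := by linarith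
  have hvar : sampleVariance x = (selectionStat x - n * sampleMean x ^ 2) / (n - 1) := by
    rw [sampleVariance, sum_sub_sampleMean_sq (by omega)]
    ring
  -- Strict positivity matters: division by zero would make `tStat x` equal to `0`.
  have hvpos : 0 < sampleVariance x := by
    rw [hvar]
    refine div_pos ?_ hn1
    have : 0 < (n : ℝ) * (1 + μ ^ 2 - η - sampleMean x ^ 2) :=
      mul_pos (by linarith) (by linarith)
    linarith
  have hvle : sampleVariance x ≤ 4 + 2 * μ ^ 2 := by
    rw [hvar, div_le_iff₀ hn1]
    have h1 : (n : ℝ) * η ≤ n * 1 := mul_le_mul_of_nonneg_left (by linarith) (by linarith)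
    have h2 : 0 ≤ (n : ℝ) * sampleMean x ^ 2 := by positivity
    -- This is `n (2 + μ²) ≤ (n - 1)(4 + 2μ²)`, the origin of the constant `4 + 2μ²`.
    have h3 : 0 ≤ ((n : ℝ) - 2) * (2 + μ ^ 2) := mul_nonneg (by linarith) (by positivity)
    linarith
  rw [tStat, abs_div, abs_mul, abs_of_nonneg (Real.sqrt_nonneg (n : ℝ)),
    abs_of_nonneg (Real.sqrt_nonneg (sampleVariance x)), div_mul_eq_mul_div, mul_comm (√(n : ℝ))]
  exact div_le_div₀ (by positivity) (mul_le_mul_of_nonneg_right hAlow (Real.sqrt_nonneg _))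
    (Real.sqrt_pos.2 hvpos) (Real.sqrt_le_sqrt hvle)

/-! ### Critical values and the deterministic rejection criterion. -/

theorem threshold_le {m n : ℕ} (hm : 0 < m) {γ δ c : ℝ} (hγ : 0 < γ) (hδ : 0 < δ)
    (htail : (chiSquared n).real (Set.Ici (n * (1 + δ))) ≤ Real.exp (-(c * n)))
    (hc : Real.exp (-(c * n)) ≤ 1 / m) : threshold m n γ ≤ n * (1 + δ) := by
  have hm' : (1 : ℝ) ≤ m := by exact_mod_cast hm
  refine chiSquaredQuantile_le (by positivity)
    (le_trans ?_ (one_sub_tail_le_real_Iic (ρ := chiSquared n) _))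
  have h1 := (measureReal_mono (μ := chiSquared n)
    (Set.Ioi_subset_Ici_self (a := (n * (1 + δ) : ℝ)))).trans (htail.trans hc)
  have h2 : 1 / (m : ℝ) ≤ (m : ℝ) ^ (-(1 - γ)) := by
    rw [one_div, ← Real.rpow_neg_one]
    exact Real.rpow_le_rpow_of_exponent_le hm' (by linarith)
  linarith

theorem studentTQuantile_bonferroni_le {m n k : ℕ} (hn : 2 ≤ n) (hk : 0 < k) (hkm : k ≤ m)
    {α d : ℝ} (hα0 : 0 < α) (hα1 : α < 1) (hd : 0 ≤ d)
    (htail : Real.exp (-(d ^ 2 / 4 * n)) + Real.exp (-(9 / 200 * n)) ≤ α / 2 / m) :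
    studentTQuantile (n - 1) (1 - α / (2 * (k : ℝ))) ≤ d * √n := by
  have hk' : (1 : ℝ) ≤ k := by exact_mod_cast hk
  have hkm' : (k : ℝ) ≤ m := by exact_mod_cast hkm
  have hn' : (2 : ℝ) ≤ n := by exact_mod_cast hn
  refine studentTQuantile_le ?_
    (le_trans ?_ (one_sub_tail_le_real_Iic (ρ := studentT (n - 1)) _))
  · rw [sub_pos, div_lt_one (by positivity)]
    linarith
  · have h := studentT_upper_tail (ν := n - 1) (by omega)
      (show 0 ≤ d * √n by positivity)
    rw [mul_pow, Real.sq_sqrt (by positivity), Nat.cast_sub (by omega), Nat.cast_one] at h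
    -- The loss of one degree of freedom is absorbed by `n - 1 ≥ n / 2`.
    have h1 : Real.exp (-(9 / 100 * ((n : ℝ) - 1))) ≤ Real.exp (-(9 / 200 * n)) :=
      Real.exp_le_exp.2 (by linarith)
    have h2 : α / 2 / m ≤ α / (2 * k) := by
      rw [div_div]
      gcongr
    rw [mul_div_right_comm] at h
    linarith

theorem rejects_of_moments_close {m n : ℕ} (hn : 2 ≤ n) {α γ μ η : ℝ}
    {x : Fin m → Fin n → ℝ} {i : Fin m}
    (hη1 : η ≤ 1 / 4) (hη2 : η ≤ |μ| / 2) (hη3 : η * |μ| ≤ 1 / 8) (hη4 : η ≤ μ ^ 2 / 2)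
    (hthr : threshold m n γ ≤ n * (1 + μ ^ 2 / 2))
    (hquant : ∀ k : ℕ, 0 < k → k ≤ m →
      studentTQuantile (n - 1) (1 - α / (2 * (k : ℝ))) ≤ |μ| / 2 / √(4 + 2 * μ ^ 2) * √n)
    (hmean : |∑ j, x i j - n * μ| < n * η)
    (hsq : |selectionStat (x i) - n * (1 + μ ^ 2)| < n * η) : Rejects α γ x i := by
  have hsel : i ∈ selected (threshold m n γ) x := by
    rw [selected, Finset.mem_filter]
    refine ⟨Finset.mem_univ _, ?_⟩
    have h1 := (abs_lt.1 hsq).1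
    have h2 : (n : ℝ) * η ≤ n * (μ ^ 2 / 2) := by gcongr
    linarith
  refine ⟨hsel, (hquant _ (Finset.card_pos.2 ⟨i, hsel⟩) ?_).trans
    (le_abs_tStat hn hη1 hη2 hη3 hmean hsq)⟩
  simpa using Finset.card_le_univ (selected (threshold m n γ) x)

/-! ### Asymptotics in `m`, and the moments of the data. -/

theorem tendsto_sampleSize {n : ℕ → ℕ} (hn : ∀ m, 1 ≤ n m)
    (hA : Tendsto (fun m : ℕ => Real.log (m : ℝ) / (n m : ℝ)) atTop (𝓝 0)) :
    Tendsto (fun m => (n m : ℝ)) atTop atTop := by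
  refine tendsto_atTop_mono' _ ?_ (Real.tendsto_log_atTop.comp tendsto_natCast_atTop_atTop)
  filter_upwards [hA.eventually_lt_const one_pos] with m hm
  rw [div_lt_one (Nat.cast_pos.2 (hn m))] at hm
  exact hm.le

/-- Half of the exponent `c n` absorbs `log m`; the other half still tends to infinity and beats
`a`. -/
theorem eventually_exp_neg_sampleSize_le {n : ℕ → ℕ} (hn : ∀ m, 1 ≤ n m)
    (hA : Tendsto (fun m : ℕ => Real.log (m : ℝ) / (n m : ℝ)) atTop (𝓝 0))
    {a c : ℝ} (ha : 0 < a) (hc : 0 < c) :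
    ∀ᶠ m : ℕ in atTop, Real.exp (-(c * n m)) ≤ a / m := by
  have hlim : Tendsto (fun m => Real.exp (-(c / 2 * n m))) atTop (𝓝 0) :=
    Real.tendsto_exp_neg_atTop_nhds_zero.comp
      ((tendsto_sampleSize hn hA).const_mul_atTop (half_pos hc))
  filter_upwards [hA.eventually_lt_const (half_pos hc), hlim.eventually_lt_const ha,
    eventually_gt_atTop 0] with m h1 h2 hm
  have hm' : (0 : ℝ) < m := Nat.cast_pos.2 hm
  rw [div_lt_iff₀ (Nat.cast_pos.2 (hn m))] at h1
  rw [le_div_iff₀ hm']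
  calc Real.exp (-(c * n m)) * m = Real.exp (-(c * n m) + Real.log m) := by
        rw [Real.exp_add, Real.exp_log hm']
    _ ≤ Real.exp (-(c / 2 * n m)) := Real.exp_le_exp.2 (by linarith)
    _ ≤ a := h2.le

theorem integral_sq_gaussianReal (μ : ℝ) : ∫ y, y ^ 2 ∂(gaussianReal μ 1) = 1 + μ ^ 2 := by
  have h := variance_eq_sub (memLp_id_gaussianReal (μ := μ) (v := 1) 2)
  simp only [variance_id_gaussianReal, Pi.pow_apply, id, integral_id_gaussianReal,
    NNReal.coe_one] at h
  linarith

theorem memLp_sq_gaussianReal (μ : ℝ) : MemLp (fun y : ℝ => y ^ 2) 2 (gaussianReal μ 1) := by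
  rw [memLp_two_iff_integrable_sq (by fun_prop)]
  have h := (memLp_id_gaussianReal (μ := μ) (v := 1) 4).integrable_norm_pow (p := 4) (by norm_num)
  refine h.congr (ae_of_all _ fun y => ?_)
  simp only [id, Real.norm_eq_abs]
  rw [← pow_mul, Even.pow_abs (by decide)]

end TwoStage

open TwoStage in
theorem corollary3p1
    (α γ ε μ₁ : ℝ)
    (hα0 : 0 < α) (hα1 : α < 1)
    (hγ0 : 0 < γ) (hγ1 : γ ≤ 1)
    (hε0 : 0 < ε) (hε1 : ε ≤ 1)
    (hμ₁ : μ₁ ≠ 0)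
    -- the common sample size, as a function of the number `m` of hypotheses
    (n : ℕ → ℕ) (hn : ∀ m, 1 ≤ n m)
    (hA : Tendsto (fun m : ℕ => Real.log (m : ℝ) / (n m : ℝ)) atTop (𝓝 0))
    -- the means, with the first one equal to `μ₁`, and the sparsity of the false hypotheses
    (μ : (m : ℕ) → Fin m → ℝ)
    (hμ : ∀ (m : ℕ) (h : 0 < m), μ m ⟨0, h⟩ = μ₁)
    (hsparse : (fun m : ℕ => (TwoStage.numFalse (μ m) : ℝ)) =Θ[atTop]
      (fun m : ℕ => (m : ℝ) ^ (1 - ε)))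
    -- the data: independent normal variables with unit variance
    {Ω : ℕ → Type*} [∀ m, MeasurableSpace (Ω m)]
    (P : (m : ℕ) → Measure (Ω m)) [∀ m, IsProbabilityMeasure (P m)]
    (X : (m : ℕ) → Fin m → Fin (n m) → Ω m → ℝ)
    (hlaw : ∀ m i j, HasLaw (X m i j) (gaussianReal (μ m i) 1) (P m))
    (hindep : ∀ m, iIndepFun (fun p : Fin m × Fin (n m) => X m p.1 p.2) (P m)) :
    Tendsto
      (fun m : ℕ => P m {ω | ∃ h : 0 < m,
        TwoStage.Rejects α γ (fun i j => X m i j ω) ⟨0, h⟩})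
      atTop (𝓝 1) := by
  have hμ0 : 0 < |μ₁| := abs_pos.2 hμ₁
  have hδ : 0 < μ₁ ^ 2 / 2 := by positivity
  set d := |μ₁| / 2 / √(4 + 2 * μ₁ ^ 2) with hd
  have hd0 : 0 < d := by positivity
  -- The tolerance must keep the sample variance positive, the sample mean above `|μ₁| / 2` in
  -- absolute value, and the selection statistic above the threshold.
  obtain ⟨η, hη0, hη1, hη2, hη3, hη4⟩ : ∃ η > 0, η ≤ 1 / 4 ∧ η ≤ |μ₁| / 2 ∧
      η * |μ₁| ≤ 1 / 8 ∧ η ≤ μ₁ ^ 2 / 2 := by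
    refine ⟨min (min (1 / 4) (|μ₁| / 2)) (min (1 / 8 / |μ₁|) (μ₁ ^ 2 / 2)), by positivity,
      (min_le_left _ _).trans (min_le_left _ _), (min_le_left _ _).trans (min_le_right _ _), ?_,
      (min_le_right _ _).trans (min_le_right _ _)⟩
    rw [← le_div_iff₀ hμ0]
    exact (min_le_right _ _).trans (min_le_left _ _)
  obtain ⟨c, hc0, hc⟩ := exists_chiSquared_upper_tail hδ
  have hsize := tendsto_sampleSize hn hA
  have herr : ∀ C : ℝ, Tendsto (fun m => ENNReal.ofReal (C / n m)) atTop (𝓝 0) := fun C => by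
    simpa using ENNReal.tendsto_ofReal (hsize.const_div_atTop C)
  set V₁ := Var[id; gaussianReal μ₁ 1] / η ^ 2
  set V₂ := Var[fun y => y ^ 2; gaussianReal μ₁ 1] / η ^ 2
  have hlower : Tendsto (fun m => 1 - (ENNReal.ofReal (V₁ / n m) + ENNReal.ofReal (V₂ / n m)))
      atTop (𝓝 1) := by
    simpa using ENNReal.Tendsto.sub tendsto_const_nhds ((herr V₁).add (herr V₂))
      (Or.inl ENNReal.one_ne_top)
  refine tendsto_of_tendsto_of_tendsto_of_le_of_le' hlower tendsto_const_nhds ?_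
    (Eventually.of_forall fun m => prob_le_one)
  filter_upwards [eventually_gt_atTop 0, hsize.eventually_ge_atTop 2,
    eventually_exp_neg_sampleSize_le hn hA one_pos hc0,
    -- The two terms of the t-tail get `α / 4` each, adding up to `α / 2 / m`.
    eventually_exp_neg_sampleSize_le hn hA (show 0 < α / 4 by positivity)
      (show 0 < d ^ 2 / 4 by positivity),
    eventually_exp_neg_sampleSize_le hn hA (show 0 < α / 4 by positivity)
      (show (0 : ℝ) < 9 / 200 by norm_num)] with m hm hn2 h1 h2 h3
  have hn2' : 2 ≤ n m := by exact_mod_cast hn2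
  have hlaw0 : ∀ j, HasLaw (X m ⟨0, hm⟩ j) (gaussianReal μ₁ 1) (P m) := fun j => by
    simpa only [hμ m hm] using hlaw m ⟨0, hm⟩ j
  have hind0 : iIndepFun (X m ⟨0, hm⟩) (P m) :=
    (hindep m).precomp (g := fun j : Fin (n m) => ((⟨0, hm⟩ : Fin m), j))
      (Prod.mk_right_injective _)
  have hb1 := measure_sum_deviation_le (hn m) hlaw0 hind0 measurable_id
    (memLp_id_gaussianReal 2) hη0
  have hb2 := measure_sum_deviation_le (hn m) hlaw0 hind0 (f := fun y => y ^ 2) (by fun_prop)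
    (memLp_sq_gaussianReal μ₁) hη0
  simp only [id, integral_id_gaussianReal] at hb1
  simp only [integral_sq_gaussianReal] at hb2
  -- Rejection can fail only where one of the two moments deviates. Covering the whole space and
  -- using subadditivity avoids measurability of the rejection event.
  have hcover : ∀ ω, ω ∈ {ω | ∃ h : 0 < m, Rejects α γ (fun i j => X m i j ω) ⟨0, h⟩} ∪
      ({ω | n m * η ≤ |∑ j, X m ⟨0, hm⟩ j ω - n m * μ₁|} ∪
        {ω | n m * η ≤ |∑ j, X m ⟨0, hm⟩ j ω ^ 2 - n m * (1 + μ₁ ^ 2)|}) := fun ω => by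
    by_contra hω
    simp only [Set.mem_union, not_or] at hω
    refine hω.1 ⟨hm, rejects_of_moments_close hn2' hη1 hη2 hη3 hη4
      (threshold_le hm hγ0 hδ (hc _) h1) (fun k hk hkm => ?_) (not_le.1 hω.2.1)
      (not_le.1 hω.2.2)⟩
    refine studentTQuantile_bonferroni_le hn2' hk hkm hα0 hα1 hd0.le ((add_le_add h2 h3).trans_eq ?_)
    ring
  rw [tsub_le_iff_right]
  calc 1 = P m Set.univ := measure_univ.symm
    _ ≤ _ := measure_mono fun ω _ => hcover ω
    _ ≤ _ := (measure_union_le _ _).trans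
      (add_le_add_right ((measure_union_le _ _).trans (add_le_add hb1 hb2)) _)
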